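/- Let $X$ be a finite set and let $\delta$ be a diversity on $X$, that is, a function from the subsets of $X$ to $[0,\infty)$ such that $\delta(A)=0$ if and only if $|A|\le 1$, and $\delta(A\cup C)\le\delta(A\cup B)+\delta(B\cup C)$ whenever $B\neq\emptyset$. (On an infinite set, a diversity is defined in the same way on the finite subsets. A semidiversity is defined in the same way, except that one only requires $\delta(A)=0$ if $|A|\le 1$, so larger sets may also have value $0$.) An isometric embedding of $(X,\delta)$ into $(Y,\eta)$, where $\eta$ is a real function on the finite subsets of $Y$, is a map $f:X\to Y$ with $\eta(f(A))=\delta(A)$ for all $A\subseteq X$. Then the following are equivalent: (i) $(X,\delta)$ embeds isometrically into a sublinear diversity $(\mathbb{R}^k,\eta)$ for some $k$, that is, a diversity with $\eta(\lambda A)=\lambda\,\eta(A)$ and $\eta(A+B)\le\eta(A)+\eta(B)$ for all $\lambda\ge 0$ and all nonempty finite $A,B\subseteq\mathbb{R}^k$, where $A+B$ is the Minkowski sum. (ii) $(X,\delta)$ embeds isometrically, for some $k$, into $(\mathbb{R}^k,\delta_K)$, where $K\subseteq\mathbb{R}^k$ is closed and convex with nonempty interior (possibly unbounded) and $\delta_K$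 is the generalized circumradius $$\delta_K(A)=\inf\{\lambda\ge 0 : A\subseteq \lambda K+x \text{ for some } x\in\mathbb{R}^k\}.$$ (ii$'$) The same as (ii), with $K$ moreover bounded. (iii) There is a collection $S$ of semidiversities $\mu$ on $X$ of negative type such that $\delta(A)=\max_{\mu\in S}\mu(A)$ for every $A\subseteq X$. Here $\mu$ has negative type if $$\sum_{A,B\subseteq X}x_A x_B\,\mu(A\cup B)\le 0$$ for all real vectors $(x_A)_{A\subseteq X}$ with $\sum_A x_A=0$ and $x_\emptyset=0$. -/

import Mathlib

open scoped Pointwise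

noncomputable section

namespace Diversity

/-- Euclidean space `ℝᵏ`. -/
abbrev Euc (k : ℕ) : Type := EuclideanSpace ℝ (Fin k)

open scoped Classical in
/-- A semidiversity on `X`: a nonnegative function on the finite subsets of `X` that vanishes on
the empty set and on singletons, and satisfies the triangle inequality for sets. -/
structure IsSemidiversity {X : Type*} (δ : Finset X → ℝ) : Prop where
  nonneg : ∀ A : Finset X, 0 ≤ δ A
  eq_zero : ∀ A : Finset X, A.card ≤ 1 → δ A = 0
  triangle : ∀ A B C : Finset X, B.Nonempty → δ (A ∪ C) ≤ δ (A ∪ B) + δ (B ∪ C)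

open scoped Classical in
/-- A diversity on `X`: a nonnegative function on the finite subsets of `X` that vanishes exactly
on the sets with at most one element, and satisfies the triangle inequality for sets. -/
structure IsDiversity {X : Type*} (δ : Finset X → ℝ) : Prop where
  nonneg : ∀ A : Finset X, 0 ≤ δ A
  eq_zero_iff : ∀ A : Finset X, δ A = 0 ↔ A.card ≤ 1
  triangle : ∀ A B C : Finset X, B.Nonempty → δ (A ∪ C) ≤ δ (A ∪ B) + δ (B ∪ C)

open scoped Classical in
/-- Minkowski sublinearity of a function on the finite subsets of `ℝᵏ`. The set `r • A` is the
dilate `{r a : a ∈ A}` and `A + B` is the Minkowski sum. -/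
structure IsSublinear {k : ℕ} (δ : Finset (Euc k) → ℝ) : Prop where
  smul : ∀ (r : ℝ) (A : Finset (Euc k)), 0 ≤ r → A.Nonempty → δ (r • A) = r * δ A
  add_le : ∀ A B : Finset (Euc k), A.Nonempty → B.Nonempty → δ (A + B) ≤ δ A + δ B

open scoped Classical in
/-- `f` is an isometric embedding of `(X, δ)` into `(Y, η)`: `η (f(A)) = δ A` for all finite `A`. -/
def IsIsometricEmbedding {X Y : Type*} (δ : Finset X → ℝ) (η : Finset Y → ℝ) (f : X → Y) : Prop :=
  ∀ A : Finset X, η (A.image f) = δ A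

/-- `(X, δ)` embeds isometrically into a sublinear diversity on `ℝᵏ` for some `k`. -/
def SublinearEmbeddable {X : Type*} (δ : Finset X → ℝ) : Prop :=
  ∃ (k : ℕ) (η : Finset (Euc k) → ℝ) (f : X → Euc k),
    IsDiversity η ∧ IsSublinear η ∧ IsIsometricEmbedding δ η f

/-- The generalized circumradius `inf {r ≥ 0 : A ⊆ r K + x for some x}` with kernel `K`. -/
def generalizedCircumradius {k : ℕ} (K : Set (Euc k)) (A : Finset (Euc k)) : ℝ :=
  sInf {r : ℝ | 0 ≤ r ∧ ∃ x : Euc k, (A : Set (Euc k)) ⊆ (fun y => r • y + x) '' K}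

/-- An admissible kernel: closed, convex, with nonempty interior, but not necessarily bounded. -/
structure IsKernel {k : ℕ} (K : Set (Euc k)) : Prop where
  isClosed : IsClosed K
  convex : Convex ℝ K
  interior_nonempty : (interior K).Nonempty

/-- `(X, δ)` embeds isometrically into `(ℝᵏ, δ_K)` for some `k` and some kernel `K`, possibly
unbounded. -/
def MinkowskiEmbeddable {X : Type*} (δ : Finset X → ℝ) : Prop :=
  ∃ (k : ℕ) (K : Set (Euc k)) (f : X → Euc k),
    IsKernel K ∧ IsIsometricEmbedding δ (generalizedCircumradius K) f

/-- `(X, δ)` embeds isometrically into `(ℝᵏ, δ_K)` for some `k` and some bounded kernel `K`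
(so that `(ℝᵏ, δ_K)` is a diversity and not only a semidiversity). -/
def BoundedMinkowskiEmbeddable {X : Type*} (δ : Finset X → ℝ) : Prop :=
  ∃ (k : ℕ) (K : Set (Euc k)) (f : X → Euc k),
    IsKernel K ∧ Bornology.IsBounded K ∧ IsIsometricEmbedding δ (generalizedCircumradius K) f

open scoped Classical in
/-- Negative type, for a function on the subsets of a finite set. -/
def HasNegativeType {X : Type*} [Fintype X] (δ : Finset X → ℝ) : Prop :=
  ∀ x : Finset X → ℝ, x ∅ = 0 → ∑ A, x A = 0 → ∑ A, ∑ B, x A * x B * δ (A ∪ B) ≤ 0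

/-- `δ` is the pointwise maximum of a collection of semidiversities of negative type. -/
def IsMaxOfNegativeType {X : Type*} [Fintype X] (δ : Finset X → ℝ) : Prop :=
  ∃ S : Set (Finset X → ℝ), (∀ μ ∈ S, IsSemidiversity μ ∧ HasNegativeType μ) ∧
    ∀ A : Finset X, IsGreatest ((fun μ => μ A) '' S) (δ A)

end Diversity

end

/-! A sublinear `η` depends on finite sets only through their convex hulls, hence through support
functions. For a vector `c` indexed by subsets of `X`, `supportGauge` takes the infimum of `η B`
over the sets `B` whose support function dominates `∑ c_A h_{f(A)}`. It is a sublinear functional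
with value `η (f(A))` at the basis vector of a nonempty `A`. By Hahn-Banach a linear `L` lies below
it and touches it there, and `μ B = L e_B` is the required semidiversity: `L` is nonpositive on
combinations dominated by a point evaluation, and both the triangle inequality and negative type
reduce to such dominations, the latter because support functions turn unions into maxima
(`sum_mul_max_le`).

Conversely, Möbius inversion writes a `μ` of negative type, up to a constant, as a nonnegative
combination of the indicators of `A ⊄ V` (`HasNegativeType.exists_weights`). Sending `a` to the
weights of the sets missing `a` turns this into the circumradius for a simplex. Using one block of
coordinates for each of finitely many `μ` attaining the maximum, a product of simplices gives that
maximum; thickening each simplex along the diagonal of its block gives interior and keeps the kernel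
bounded. -/

noncomputable section

namespace Diversity

open scoped Classical

/-! ### Monotonicity of semidiversities. -/

section Basic

variable {Y : Type*} {η : Finset Y → ℝ}

theorem IsDiversity.isSemidiversity (h : IsDiversity η) : IsSemidiversity η :=
  ⟨h.nonneg, fun A hA => (h.eq_zero_iff A).2 hA, h.triangle⟩

theorem IsSemidiversity.singleton (h : IsSemidiversity η) (a : Y) : η {a} = 0 :=
  h.eq_zero _ (by simp)

theorem IsSemidiversity.mono (h : IsSemidiversity η) {A B : Finset Y} (hAB : A ⊆ B) :
    η A ≤ η B := by
  have step : ∀ (C : Finset Y) (b : Y), η C ≤ η (insert b C) := by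
    intro C b
    have := h.triangle C {b} ∅ (by simp)
    rw [Finset.union_empty, Finset.union_empty, h.singleton, add_zero, Finset.union_comm,
      ← Finset.insert_eq] at this
    exact this
  have key : ∀ C : Finset Y, η A ≤ η (A ∪ C) := by
    intro C
    induction C using Finset.induction_on with
    | empty => simp
    | insert b C _ ih =>
      rw [Finset.union_insert]
      exact ih.trans (step _ _)
  simpa [Finset.union_eq_right.2 hAB] using key B

end Basic

/-! ### Sublinear semidiversities and convex hulls. -/

section ConvexHull

variable {k : ℕ} {η : Finset (Euc k) → ℝ}

/-- The witness is the Minkowski sum of the dilates `w y • A`; a choice of one point `p y` of `A` in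
each summand gives an element of it. -/
theorem IsSublinear.exists_weighted_sum (hs : IsSemidiversity η) (hl : IsSublinear η)
    {A : Finset (Euc k)} (hA : A.Nonempty) (w : Euc k → ℝ) (T : Finset (Euc k))
    (hw : ∀ y ∈ T, 0 ≤ w y) :
    ∃ C : Finset (Euc k), C.Nonempty ∧ η C ≤ (∑ y ∈ T, w y) * η A ∧
      ∀ p : Euc k → Euc k, (∀ y ∈ T, p y ∈ A) → ∑ y ∈ T, w y • p y ∈ C := by
  induction T using Finset.induction_on with
  | empty => exact ⟨{0}, by simp, by simp [hs.singleton], by simp⟩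
  | insert b T hb ih =>
    obtain ⟨C, hC, hη, hp⟩ := ih fun y hy => hw y (Finset.mem_insert_of_mem hy)
    have hb0 : 0 ≤ w b := hw b (Finset.mem_insert_self _ _)
    have hbA : (w b • A).Nonempty := hA.smul_finset
    refine ⟨w b • A + C, hbA.add hC, ?_, fun p h => ?_⟩
    · rw [Finset.sum_insert hb, add_mul, ← hl.smul _ _ hb0 hA]
      exact (hl.add_le _ _ hbA hC).trans (by gcongr)
    · rw [Finset.sum_insert hb]
      exact Finset.add_mem_add (Finset.smul_mem_smul_finset (h b (Finset.mem_insert_self _ _)))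
        (hp p fun y hy => h y (Finset.mem_insert_of_mem hy))

theorem IsSublinear.insert_le (hs : IsSemidiversity η) (hl : IsSublinear η)
    {A : Finset (Euc k)} (hA : A.Nonempty) {b : Euc k}
    (hb : b ∈ convexHull ℝ (A : Set (Euc k))) : η (insert b A) ≤ η A := by
  obtain ⟨w, hw, hw1, rfl⟩ := Finset.mem_convexHull'.1 hb
  obtain ⟨C, -, hη, hp⟩ := hl.exists_weighted_sum hs hA w A hw
  rw [hw1, one_mul] at hη
  refine (hs.mono fun a ha => ?_).trans hη
  rcases Finset.mem_insert.1 ha with rfl | ha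
  -- The identity choice produces the convex combination; constant choices produce the points of
  -- `A`.
  · exact hp id fun y hy => hy
  · have := hp (fun _ => a) fun _ _ => ha
    rwa [← Finset.sum_smul, hw1, one_smul] at this

theorem IsSublinear.le_of_subset_convexHull (hs : IsSemidiversity η) (hl : IsSublinear η)
    {A B : Finset (Euc k)} (hA : A.Nonempty)
    (hB : (B : Set (Euc k)) ⊆ convexHull ℝ (A : Set (Euc k))) : η B ≤ η A := by
  suffices η (B ∪ A) ≤ η A from (hs.mono Finset.subset_union_left).trans this
  induction B using Finset.induction_on with
  | empty => simp
  | insert b B _ ih =>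
    rw [Finset.coe_insert, Set.insert_subset_iff] at hB
    rw [Finset.insert_union]
    refine (hl.insert_le hs (hA.mono Finset.subset_union_right) ?_).trans (ih hB.2)
    exact convexHull_mono (by simp) hB.1

end ConvexHull

/-! ### Support functions of finite sets. -/

section SupportFun

variable {k : ℕ}

/-- The support function of a finite set, with value `0` for the empty set. -/
def supportFun (A : Finset (Euc k)) (φ : StrongDual ℝ (Euc k)) : ℝ :=
  if h : A.Nonempty then A.sup' h φ else 0

@[simp]
theorem supportFun_empty (φ : StrongDual ℝ (Euc k)) : supportFun ∅ φ = 0 := by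
  simp [supportFun]

@[simp]
theorem supportFun_singleton (a : Euc k) (φ : StrongDual ℝ (Euc k)) :
    supportFun {a} φ = φ a := by
  simp [supportFun]

theorem supportFun_le_iff {A : Finset (Euc k)} (hA : A.Nonempty) {φ : StrongDual ℝ (Euc k)}
    {c : ℝ} : supportFun A φ ≤ c ↔ ∀ a ∈ A, φ a ≤ c := by
  simp [supportFun, hA]

theorem le_supportFun {A : Finset (Euc k)} {a : Euc k} (ha : a ∈ A) (φ : StrongDual ℝ (Euc k)) :
    φ a ≤ supportFun A φ :=
  (supportFun_le_iff ⟨a, ha⟩).1 le_rfl a ha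

theorem exists_supportFun_eq {A : Finset (Euc k)} (hA : A.Nonempty)
    (φ : StrongDual ℝ (Euc k)) : ∃ a ∈ A, supportFun A φ = φ a := by
  simpa [supportFun, hA] using Finset.exists_mem_eq_sup' hA φ

theorem supportFun_union {A B : Finset (Euc k)} (hA : A.Nonempty) (hB : B.Nonempty)
    (φ : StrongDual ℝ (Euc k)) :
    supportFun (A ∪ B) φ = max (supportFun A φ) (supportFun B φ) := by
  simp [supportFun, hA, hB, Finset.sup'_union hA hB]

theorem supportFun_add {A B : Finset (Euc k)} (hA : A.Nonempty) (hB : B.Nonempty)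
    (φ : StrongDual ℝ (Euc k)) :
    supportFun (A + B) φ = supportFun A φ + supportFun B φ := by
  apply le_antisymm
  · rw [supportFun_le_iff (hA.add hB)]
    intro c hc
    obtain ⟨a, ha, b, hb, rfl⟩ := Finset.mem_add.1 hc
    rw [map_add]
    exact add_le_add (le_supportFun ha φ) (le_supportFun hb φ)
  · obtain ⟨a, ha, ha'⟩ := exists_supportFun_eq hA φ
    obtain ⟨b, hb, hb'⟩ := exists_supportFun_eq hB φ
    rw [ha', hb', ← map_add]
    exact le_supportFun (Finset.add_mem_add ha hb) φ

theorem supportFun_smul {A : Finset (Euc k)} (hA : A.Nonempty) {r : ℝ} (hr : 0 ≤ r)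
    (φ : StrongDual ℝ (Euc k)) : supportFun (r • A) φ = r * supportFun A φ := by
  apply le_antisymm
  · rw [supportFun_le_iff hA.smul_finset]
    intro c hc
    obtain ⟨a, ha, rfl⟩ := Finset.mem_smul_finset.1 hc
    rw [map_smul, smul_eq_mul]
    exact mul_le_mul_of_nonneg_left (le_supportFun ha φ) hr
  · obtain ⟨a, ha, ha'⟩ := exists_supportFun_eq hA φ
    rw [ha', ← smul_eq_mul, ← map_smul]
    exact le_supportFun (Finset.smul_mem_smul_finset ha) φ

theorem subset_convexHull_of_supportFun_le {A B : Finset (Euc k)}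
    (h : ∀ φ, supportFun B φ ≤ supportFun A φ) (hA : A.Nonempty) :
    (B : Set (Euc k)) ⊆ convexHull ℝ (A : Set (Euc k)) := by
  intro b hb
  by_contra hb'
  obtain ⟨φ, u, h1, h2⟩ := geometric_hahn_banach_closed_point (convex_convexHull ℝ _)
    (A.finite_toSet.isClosed_convexHull ℝ) hb'
  have h3 : supportFun A φ ≤ u :=
    (supportFun_le_iff hA).2 fun a ha => (h1 a (subset_convexHull ℝ _ ha)).le
  linarith [le_supportFun (A := B) hb φ, h φ]

end SupportFun

/-- Indices are added in increasing order of `s`, so each new maximum is `s a`. The induction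
hypothesis at bound `s a` completes a square. When the `x i` sum to zero, this is negative type of
the maximum. -/
theorem sum_mul_max_le {ι : Type*} (s x : ι → ℝ) (T : Finset ι) (M : ℝ)
    (hM : ∀ i ∈ T, s i ≤ M) :
    ∑ i ∈ T, ∑ j ∈ T, x i * x j * max (s i) (s j) ≤ M * (∑ i ∈ T, x i) ^ 2 := by
  induction T using Finset.induction_on_max_value s generalizing M with
  | empty => simp
  | insert a T ha hmax ih =>
    have h1 := ih (s a) hmax
    have h2 : ∑ i ∈ insert a T, ∑ j ∈ insert a T, x i * x j * max (s i) (s j) =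
        x a ^ 2 * s a + 2 * (x a * s a) * ∑ i ∈ T, x i +
          ∑ i ∈ T, ∑ j ∈ T, x i * x j * max (s i) (s j) := by
      simp only [Finset.sum_insert ha, max_self, Finset.sum_add_distrib]
      have e1 : ∑ j ∈ T, x a * x j * max (s a) (s j) = x a * s a * ∑ i ∈ T, x i := by
        rw [Finset.mul_sum]
        exact Finset.sum_congr rfl fun j hj => by rw [max_eq_left (hmax j hj)]; ring
      have e2 : ∑ j ∈ T, x j * x a * max (s j) (s a) = x a * s a * ∑ i ∈ T, x i := by
        rw [Finset.mul_sum]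
        exact Finset.sum_congr rfl fun j hj => by rw [max_eq_right (hmax j hj)]; ring
      rw [e1, e2]
      ring
    rw [h2, Finset.sum_insert ha]
    have h3 : s a * (x a + ∑ i ∈ T, x i) ^ 2 ≤ M * (x a + ∑ i ∈ T, x i) ^ 2 :=
      mul_le_mul_of_nonneg_right (hM a (Finset.mem_insert_self _ _)) (sq_nonneg _)
    linarith

/-- A nonnegative sublinear functional has a tangent linear functional at every point. -/
theorem exists_linearMap_le_of_sublinear {E : Type*} [AddCommGroup E] [Module ℝ E] (N : E → ℝ)
    (N_nonneg : ∀ x, 0 ≤ N x) (N_hom : ∀ c : ℝ, 0 < c → ∀ x, N (c • x) = c * N x)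
    (N_add : ∀ x y, N (x + y) ≤ N x + N y) (x₀ : E) :
    ∃ g : E →ₗ[ℝ] ℝ, g x₀ = N x₀ ∧ ∀ x, g x ≤ N x := by
  have N0 : N 0 = 0 := by
    have := N_hom 2 (by norm_num) 0
    rw [smul_zero] at this
    linarith
  rcases eq_or_ne x₀ 0 with rfl | hx₀
  · exact ⟨0, by simp [N0], fun x => by simpa using N_nonneg x⟩
  obtain ⟨g, hg, hgN⟩ := exists_extension_of_le_sublinear
    (LinearPMap.mkSpanSingleton (K := ℝ) x₀ (N x₀) hx₀) N N_hom N_add (by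
      rintro ⟨x, hx⟩
      obtain ⟨c, rfl⟩ := Submodule.mem_span_singleton.1 hx
      rw [LinearPMap.mkSpanSingleton'_apply, smul_eq_mul]
      rcases lt_trichotomy c 0 with hc | rfl | hc
      · exact (mul_nonpos_of_nonpos_of_nonneg hc.le (N_nonneg _)).trans (N_nonneg _)
      · simp [N0]
      · rw [N_hom c hc, RingHom.id_apply])
  refine ⟨g, ?_, hgN⟩
  exact (hg ⟨x₀, Submodule.mem_span_singleton_self x₀⟩).trans
    (LinearPMap.mkSpanSingleton_apply ℝ ℝ hx₀ _)

/-! ### The gauge on combinations of support functions and its tangent functionals. -/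

section Gauge

variable {X : Type*} [Fintype X] {k : ℕ}

/-- The combination of the support functions of the images of the subsets of `X`. -/
def supportComb (f : X → Euc k) (φ : StrongDual ℝ (Euc k)) : (Finset X → ℝ) →ₗ[ℝ] ℝ :=
  ∑ A, supportFun (A.image f) φ • LinearMap.proj A

@[simp]
theorem supportComb_single (f : X → Euc k) (A : Finset X) (φ : StrongDual ℝ (Euc k)) :
    supportComb f φ (Pi.single A 1) = supportFun (A.image f) φ := by
  simp [supportComb, Pi.single_apply]

/-- Ensures that the infimum in `supportGauge` is over a nonempty set. Even for `c A < 0`, the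
support function of the scaled set dominates `c A` times the original one. -/
theorem exists_supportComb_le (f : X → Euc k) (c : Finset X → ℝ) :
    ∃ B : Finset (Euc k), B.Nonempty ∧ ∀ φ, supportComb f φ c ≤ supportFun B φ := by
  suffices ∀ T : Finset (Finset X), ∃ B : Finset (Euc k), B.Nonempty ∧
      ∀ φ, ∑ A ∈ T, c A * supportFun (A.image f) φ ≤ supportFun B φ by
    simpa [supportComb, mul_comm] using this Finset.univ
  intro T
  induction T using Finset.induction_on with
  | empty => exact ⟨{0}, by simp, by simp⟩
  | insert A T hA ih =>
    obtain ⟨B, hB, h⟩ := ih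
    rcases A.eq_empty_or_nonempty with rfl | hne
    · exact ⟨B, hB, fun φ => by simpa [Finset.sum_insert hA] using h φ⟩
    have hD : ((A.image f).image fun a => c A • a).Nonempty := (hne.image f).image _
    refine ⟨(A.image f).image (fun a => c A • a) + B, hD.add hB, fun φ => ?_⟩
    rw [Finset.sum_insert hA, supportFun_add hD hB]
    refine add_le_add ?_ (h φ)
    obtain ⟨a, ha, ha'⟩ := exists_supportFun_eq (hne.image f) φ
    rw [ha', ← smul_eq_mul, ← map_smul]
    exact le_supportFun (Finset.mem_image_of_mem _ ha) φ

/-- The least value of `η` on a finite set whose support function dominates the combination `c`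
of support functions. -/
def supportGauge (η : Finset (Euc k) → ℝ) (f : X → Euc k) (c : Finset X → ℝ) : ℝ :=
  sInf {t | ∃ B : Finset (Euc k), B.Nonempty ∧ (∀ φ, supportComb f φ c ≤ supportFun B φ) ∧
    η B = t}

variable {η : Finset (Euc k) → ℝ}

theorem supportGauge_le (hs : IsSemidiversity η) {f : X → Euc k} {c : Finset X → ℝ}
    {B : Finset (Euc k)} (hB : B.Nonempty) (h : ∀ φ, supportComb f φ c ≤ supportFun B φ) :
    supportGauge η f c ≤ η B :=
  csInf_le ⟨0, by rintro _ ⟨B, -, -, rfl⟩; exact hs.nonneg B⟩ ⟨B, hB, h, rfl⟩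

theorem le_supportGauge {f : X → Euc k} {c : Finset X → ℝ} {t : ℝ}
    (h : ∀ B : Finset (Euc k), B.Nonempty → (∀ φ, supportComb f φ c ≤ supportFun B φ) →
      t ≤ η B) : t ≤ supportGauge η f c := by
  obtain ⟨B, hB, hc⟩ := exists_supportComb_le f c
  refine le_csInf ⟨_, B, hB, hc, rfl⟩ ?_
  rintro _ ⟨B, hB, hc, rfl⟩
  exact h B hB hc

theorem supportGauge_nonneg (hs : IsSemidiversity η) (f : X → Euc k) (c : Finset X → ℝ) :
    0 ≤ supportGauge η f c :=
  le_supportGauge fun B _ _ => hs.nonneg B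

theorem supportGauge_smul_le (hs : IsSemidiversity η) (hl : IsSublinear η) (f : X → Euc k)
    (c : Finset X → ℝ) {r : ℝ} (hr : 0 < r) :
    supportGauge η f (r • c) ≤ r * supportGauge η f c := by
  rw [← div_le_iff₀' hr]
  refine le_supportGauge fun B hB hc => ?_
  rw [div_le_iff₀' hr, ← hl.smul r B hr.le hB]
  refine supportGauge_le hs hB.smul_finset fun φ => ?_
  rw [map_smul, smul_eq_mul, supportFun_smul hB hr.le]
  exact mul_le_mul_of_nonneg_left (hc φ) hr.le

theorem supportGauge_smul (hs : IsSemidiversity η) (hl : IsSublinear η) (f : X → Euc k)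
    (c : Finset X → ℝ) {r : ℝ} (hr : 0 < r) :
    supportGauge η f (r • c) = r * supportGauge η f c := by
  refine (supportGauge_smul_le hs hl f c hr).antisymm ?_
  have := supportGauge_smul_le hs hl f (r • c) (inv_pos.2 hr)
  rwa [smul_smul, inv_mul_cancel₀ hr.ne', one_smul, ← div_eq_inv_mul, le_div_iff₀' hr] at this

theorem supportGauge_add_le (hs : IsSemidiversity η) (hl : IsSublinear η) (f : X → Euc k)
    (c d : Finset X → ℝ) :
    supportGauge η f (c + d) ≤ supportGauge η f c + supportGauge η f d := by
  rw [← sub_le_iff_le_add]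
  refine le_supportGauge fun B hB hc => ?_
  rw [sub_le_comm]
  refine le_supportGauge fun D hD hd => ?_
  rw [sub_le_iff_le_add']
  refine (supportGauge_le hs (hB.add hD) fun φ => ?_).trans (hl.add_le B D hB hD)
  rw [map_add, supportFun_add hB hD]
  exact add_le_add (hc φ) (hd φ)

theorem supportGauge_single (hs : IsSemidiversity η) (hl : IsSublinear η) (f : X → Euc k)
    {A : Finset X} (hA : A.Nonempty) :
    supportGauge η f (Pi.single A 1) = η (A.image f) := by
  refine (supportGauge_le hs (hA.image f) (by simp)).antisymm (le_supportGauge fun B hB h => ?_)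
  simp only [supportComb_single] at h
  exact hl.le_of_subset_convexHull hs hB (subset_convexHull_of_supportFun_le h hB)

theorem map_le_map_of_supportComb {f : X → Euc k} {L : (Finset X → ℝ) →ₗ[ℝ] ℝ}
    (hL : ∀ c v, (∀ φ, supportComb f φ c ≤ φ v) → L c ≤ 0) {c d : Finset X → ℝ} (v : Euc k)
    (h : ∀ φ, supportComb f φ c ≤ supportComb f φ d + φ v) : L c ≤ L d := by
  have := hL (c + (-1 : ℝ) • d) v fun φ => by
    rw [map_add, map_smul, smul_eq_mul]
    linarith [h φ]
  rw [map_add, map_smul, smul_eq_mul] at this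
  linarith

/-- For `b ∈ B`, the triangle inequality comes from `h_{A∪C} ≤ h_{A∪B} + h_{B∪C} - φ (f b)`, whose
linear term is invisible to `L`. -/
theorem isSemidiversity_of_supportComb {f : X → Euc k} {L : (Finset X → ℝ) →ₗ[ℝ] ℝ}
    (hL : ∀ c v, (∀ φ, supportComb f φ c ≤ φ v) → L c ≤ 0) :
    IsSemidiversity fun A => L (Pi.single A 1) := by
  have h0 : L (Pi.single ∅ 1) = 0 := by
    refine le_antisymm (hL _ 0 fun φ => by simp) ?_
    rw [← map_zero L]
    refine map_le_map_of_supportComb hL 0 fun φ => ?_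
    simp
  have h1 : ∀ a, L (Pi.single {a} 1) = 0 := by
    intro a
    refine le_antisymm (hL _ (f a) fun φ => by simp) ?_
    rw [← map_zero L]
    refine map_le_map_of_supportComb hL (-f a) fun φ => ?_
    rw [supportComb_single]
    simp
  have hnn : ∀ A, 0 ≤ L (Pi.single A 1) := by
    intro A
    rcases A.eq_empty_or_nonempty with rfl | ⟨a, ha⟩
    · exact h0.ge
    · rw [← h1 a]
      refine map_le_map_of_supportComb hL 0 fun φ => ?_
      simpa using le_supportFun (Finset.mem_image_of_mem f ha) φ
  refine ⟨hnn, fun A hA => ?_, fun A B C ⟨b, hb⟩ => ?_⟩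
  · rcases A.eq_empty_or_nonempty with rfl | hne
    · exact h0
    · obtain ⟨a, rfl⟩ := Finset.card_eq_one.1 (hA.antisymm hne.card_pos)
      exact h1 a
  · rcases (A ∪ C).eq_empty_or_nonempty with hAC | hAC
    · rw [hAC, h0]
      exact add_nonneg (hnn _) (hnn _)
    rw [← map_add]
    refine map_le_map_of_supportComb hL (-f b) fun φ => ?_
    rw [map_add, supportComb_single, supportComb_single, supportComb_single, map_neg,
      ← sub_eq_add_neg, supportFun_le_iff (hAC.image f)]
    have hle : ∀ {x : X} {D : Finset X}, x ∈ D → φ (f x) ≤ supportFun (D.image f) φ :=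
      fun hx => le_supportFun (Finset.mem_image_of_mem f hx) φ
    intro y hy
    obtain ⟨x, hx, rfl⟩ := Finset.mem_image.1 hy
    rcases Finset.mem_union.1 hx with hx | hx
    · linarith [hle (D := A ∪ B) (Finset.mem_union_left _ hx),
        hle (D := B ∪ C) (Finset.mem_union_left _ hb)]
    · linarith [hle (D := A ∪ B) (Finset.mem_union_right _ hb),
        hle (D := B ∪ C) (Finset.mem_union_right _ hx)]

theorem hasNegativeType_of_supportComb {f : X → Euc k} {L : (Finset X → ℝ) →ₗ[ℝ] ℝ}
    (hL : ∀ c v, (∀ φ, supportComb f φ c ≤ φ v) → L c ≤ 0) :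
    HasNegativeType fun A => L (Pi.single A 1) := by
  intro x hx0 hx
  have hsum : ∑ A, ∑ B, x A * x B * L (Pi.single (A ∪ B) 1) =
      L (∑ A, ∑ B, (x A * x B) • Pi.single (A ∪ B) 1) := by
    simp only [map_sum, map_smul, smul_eq_mul]
  rw [hsum]
  refine hL _ 0 fun φ => ?_
  have hcomb : supportComb f φ (∑ A, ∑ B, (x A * x B) • Pi.single (A ∪ B) 1) =
      ∑ A, ∑ B, x A * x B * supportFun ((A ∪ B).image f) φ := by
    simp only [map_sum, map_smul, smul_eq_mul, supportComb_single]
  rw [hcomb, map_zero]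
  obtain ⟨M, hM⟩ := (Set.finite_range fun A : Finset X => supportFun (A.image f) φ).bddAbove
  have hmax := sum_mul_max_le (fun A => supportFun (A.image f) φ) x Finset.univ M
    fun A _ => hM ⟨A, rfl⟩
  rw [hx, zero_pow two_ne_zero, mul_zero] at hmax
  -- The empty set has support function `0` rather than `-∞`, so the union formula fails for it; `x
  -- ∅ = 0` removes those terms.
  refine (Finset.sum_congr rfl fun A _ => Finset.sum_congr rfl fun B _ => ?_).trans_le hmax
  rcases A.eq_empty_or_nonempty with rfl | hA
  · simp [hx0]
  rcases B.eq_empty_or_nonempty with rfl | hB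
  · simp [hx0]
  rw [Finset.image_union, supportFun_union (hA.image f) (hB.image f)]

theorem IsSublinear.exists_negativeType (hs : IsSemidiversity η) (hl : IsSublinear η)
    (f : X → Euc k) {A : Finset X} (hA : A.Nonempty) :
    ∃ μ : Finset X → ℝ, IsSemidiversity μ ∧ HasNegativeType μ ∧
      (∀ B, μ B ≤ η (B.image f)) ∧ μ A = η (A.image f) := by
  obtain ⟨L, hLA, hLN⟩ := exists_linearMap_le_of_sublinear (supportGauge η f)
    (supportGauge_nonneg hs f) (fun r hr c => supportGauge_smul hs hl f c hr)
    (supportGauge_add_le hs hl f) (Pi.single A 1)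
  have hL : ∀ c v, (∀ φ, supportComb f φ c ≤ φ v) → L c ≤ 0 := fun c v h =>
    (hLN c).trans ((supportGauge_le hs (Finset.singleton_nonempty v) (by simpa using h)).trans
      (hs.singleton v).le)
  have hμ := isSemidiversity_of_supportComb hL
  refine ⟨_, hμ, hasNegativeType_of_supportComb hL, fun B => ?_, ?_⟩
  · rcases B.eq_empty_or_nonempty with rfl | hB
    · exact (hμ.eq_zero ∅ (by simp)).trans_le (hs.nonneg _)
    · exact (hLN _).trans (supportGauge_single hs hl f hB).le
  · exact hLA.trans (supportGauge_single hs hl f hA)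

/-- A finite family of points in `ℝᵏ` with a sublinear semidiversity carries a maximum of
semidiversities of negative type. -/
theorem IsSublinear.isMaxOfNegativeType (hs : IsSemidiversity η) (hl : IsSublinear η)
    {δ : Finset X → ℝ} {f : X → Euc k} (hf : IsIsometricEmbedding δ η f) :
    IsMaxOfNegativeType δ := by
  have hf' : ∀ A, η (A.image f) = δ A := fun A => by convert hf A
  -- The collection consists of all minorants of `δ` of the right kind, so only attainment needs
  -- proof.
  refine ⟨{μ | (IsSemidiversity μ ∧ HasNegativeType μ) ∧ ∀ B, μ B ≤ δ B}, fun μ hμ => hμ.1,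
    fun A => ⟨?_, ?_⟩⟩
  · rcases A.eq_empty_or_nonempty with rfl | hA
    · refine ⟨0, ⟨⟨⟨by simp, by simp, by simp⟩, fun x _ _ => by simp⟩, fun B => ?_⟩, ?_⟩
      · rw [← hf' B]
        exact hs.nonneg _
      · rw [← hf' ∅]
        exact (hs.eq_zero _ (by simp)).symm
    · obtain ⟨μ, h1, h2, h3, h4⟩ := hl.exists_negativeType hs f hA
      exact ⟨μ, ⟨⟨h1, h2⟩, fun B => (h3 B).trans_eq (hf' B)⟩, h4.trans (hf' A)⟩
  · rintro _ ⟨μ, hμ, rfl⟩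
    exact hμ.2 A

end Gauge

/-! ### Generalized circumradii are sublinear semidiversities. -/

section Circumradius

variable {k : ℕ} {K : Set (Euc k)}

/-- The set of scales `r` at which some translate of `r K` covers `A`. -/
def coverScales (K : Set (Euc k)) (A : Finset (Euc k)) : Set ℝ :=
  {r : ℝ | 0 ≤ r ∧ ∃ x : Euc k, ∀ a ∈ A, ∃ y ∈ K, r • y + x = a}

theorem bddBelow_coverScales (K : Set (Euc k)) (A : Finset (Euc k)) :
    BddBelow (coverScales K A) :=
  ⟨0, fun _ h => h.1⟩

theorem generalizedCircumradius_le {A : Finset (Euc k)} {r : ℝ} (h : r ∈ coverScales K A) :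
    generalizedCircumradius K A ≤ r :=
  csInf_le (bddBelow_coverScales K A) h

theorem generalizedCircumradius_nonneg (K : Set (Euc k)) (A : Finset (Euc k)) :
    0 ≤ generalizedCircumradius K A :=
  Real.sInf_nonneg fun _ h => h.1

theorem generalizedCircumradius_eq_zero (hK : K.Nonempty) {A : Finset (Euc k)}
    (hA : A.card ≤ 1) : generalizedCircumradius K A = 0 := by
  refine le_antisymm (generalizedCircumradius_le ⟨le_rfl, ?_⟩)
    (generalizedCircumradius_nonneg K A)
  obtain ⟨y, hy⟩ := hK
  obtain ⟨x, hx⟩ := Finset.card_le_one_iff_subset_singleton.1 hA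
  exact ⟨x, fun a ha => ⟨y, hy, by simpa using (Finset.mem_singleton.1 (hx ha)).symm⟩⟩

theorem IsKernel.nonempty (hK : IsKernel K) : K.Nonempty :=
  hK.interior_nonempty.mono interior_subset

theorem IsKernel.coverScales_nonempty (hK : IsKernel K) (A : Finset (Euc k)) :
    (coverScales K A).Nonempty := by
  obtain ⟨c, hc⟩ := hK.interior_nonempty
  obtain ⟨ε, hε, hball⟩ := Metric.isOpen_iff.1 isOpen_interior c hc
  obtain ⟨R, hR, hAR⟩ := A.finite_toSet.isBounded.exists_pos_norm_lt
  have hr : 0 < R / ε := div_pos hR hε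
  refine ⟨R / ε, hr.le, -((R / ε) • c), fun a ha => ⟨c + (R / ε)⁻¹ • a, ?_, ?_⟩⟩
  · refine interior_subset (hball ?_)
    rw [mem_ball_iff_norm, add_sub_cancel_left, norm_smul, Real.norm_of_nonneg (inv_pos.2 hr).le,
      inv_mul_lt_iff₀ hr, div_mul_cancel₀ _ hε.ne']
    exact hAR a ha
  · rw [smul_add, smul_inv_smul₀ hr.ne']
    abel

theorem IsKernel.le_generalizedCircumradius (hK : IsKernel K) {A : Finset (Euc k)} {t : ℝ}
    (h : ∀ r ∈ coverScales K A, t ≤ r) : t ≤ generalizedCircumradius K A :=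
  le_csInf (hK.coverScales_nonempty A) h

theorem IsKernel.le_generalizedCircumradius_add (hK : IsKernel K) {A B : Finset (Euc k)} {t : ℝ}
    (h : ∀ r ∈ coverScales K A, ∀ s ∈ coverScales K B, t ≤ r + s) :
    t ≤ generalizedCircumradius K A + generalizedCircumradius K B := by
  rw [← sub_le_iff_le_add]
  refine hK.le_generalizedCircumradius fun r hr => ?_
  rw [sub_le_comm]
  refine hK.le_generalizedCircumradius fun s hs => ?_
  rw [sub_le_iff_le_add']
  exact h r hr s hs

theorem IsKernel.exists_add_smul (hK : IsKernel K) {r s : ℝ} (hr : 0 ≤ r) (hs : 0 ≤ s)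
    {y z : Euc k} (hy : y ∈ K) (hz : z ∈ K) : ∃ w ∈ K, (r + s) • w = r • y + s • z := by
  have := hK.convex.add_smul hr hs ▸
    Set.add_mem_add (Set.smul_mem_smul_set (a := r) hy) (Set.smul_mem_smul_set (a := s) hz)
  exact Set.mem_smul_set.1 this

theorem IsKernel.generalizedCircumradius_triangle [DecidableEq (Euc k)] (hK : IsKernel K)
    {A B C : Finset (Euc k)} (hB : B.Nonempty) :
    generalizedCircumradius K (A ∪ C) ≤
      generalizedCircumradius K (A ∪ B) + generalizedCircumradius K (B ∪ C) := by
  obtain ⟨b, hb⟩ := hB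
  refine hK.le_generalizedCircumradius_add ?_
  rintro r ⟨hr, x, hx⟩ s ⟨hs, z, hz⟩
  obtain ⟨y₁, hy₁, hb₁⟩ := hx b (Finset.mem_union_right _ hb)
  obtain ⟨y₂, hy₂, hb₂⟩ := hz b (Finset.mem_union_left _ hb)
  -- This translation equals `x + z - b`: the two covering bodies are added and shifted back by
  -- their common point `b`.
  refine generalizedCircumradius_le ⟨add_nonneg hr hs, b - r • y₁ - s • y₂, fun a ha => ?_⟩
  rcases Finset.mem_union.1 ha with ha | ha
  · obtain ⟨y, hy, rfl⟩ := hx a (Finset.mem_union_left _ ha)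
    obtain ⟨w, hw, h⟩ := hK.exists_add_smul hr hs hy hy₂
    refine ⟨w, hw, ?_⟩
    rw [h, ← hb₁]
    abel
  · obtain ⟨y, hy, rfl⟩ := hz a (Finset.mem_union_right _ ha)
    obtain ⟨w, hw, h⟩ := hK.exists_add_smul hr hs hy₁ hy
    refine ⟨w, hw, ?_⟩
    rw [h, ← hb₂]
    abel

theorem IsKernel.isSemidiversity (hK : IsKernel K) :
    IsSemidiversity (generalizedCircumradius K) :=
  ⟨generalizedCircumradius_nonneg K,
    fun _ hA => generalizedCircumradius_eq_zero hK.nonempty hA,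
    fun A B C hB => by convert hK.generalizedCircumradius_triangle (A := A) (C := C) hB⟩

theorem IsKernel.generalizedCircumradius_smul_le (hK : IsKernel K) {r : ℝ} (hr : 0 < r)
    (A : Finset (Euc k)) :
    generalizedCircumradius K (r • A) ≤ r * generalizedCircumradius K A := by
  rw [← div_le_iff₀' hr]
  refine hK.le_generalizedCircumradius ?_
  rintro s ⟨hs, x, hx⟩
  rw [div_le_iff₀' hr]
  refine generalizedCircumradius_le ⟨mul_nonneg hr.le hs, r • x, fun a ha => ?_⟩
  obtain ⟨a', ha', rfl⟩ := Finset.mem_smul_finset.1 ha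
  obtain ⟨y, hy, rfl⟩ := hx a' ha'
  exact ⟨y, hy, by rw [smul_add, mul_smul]⟩

theorem IsKernel.isSublinear (hK : IsKernel K) : IsSublinear (generalizedCircumradius K) := by
  refine ⟨fun r A hr hA => ?_, fun A B _ _ => ?_⟩
  · rcases hr.eq_or_lt with rfl | hr
    · rw [Finset.zero_smul_finset hA, zero_mul]
      exact generalizedCircumradius_eq_zero hK.nonempty (by simp)
    · refine (hK.generalizedCircumradius_smul_le hr A).antisymm ?_
      have := hK.generalizedCircumradius_smul_le (inv_pos.2 hr) (r • A)
      rwa [inv_smul_smul₀ hr.ne', ← div_eq_inv_mul, le_div_iff₀' hr] at this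
  · refine hK.le_generalizedCircumradius_add ?_
    rintro r ⟨hr, x, hx⟩ s ⟨hs, z, hz⟩
    refine generalizedCircumradius_le ⟨add_nonneg hr hs, x + z, fun c hc => ?_⟩
    obtain ⟨a, ha, b, hb, rfl⟩ := Finset.mem_add.1 hc
    obtain ⟨y, hy, rfl⟩ := hx a ha
    obtain ⟨y', hy', rfl⟩ := hz b hb
    obtain ⟨w, hw, h⟩ := hK.exists_add_smul hr hs hy hy'
    refine ⟨w, hw, ?_⟩
    rw [h]
    abel

theorem IsKernel.isDiversity (hK : IsKernel K) (hb : Bornology.IsBounded K) :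
    IsDiversity (generalizedCircumradius K) := by
  refine ⟨hK.isSemidiversity.nonneg, fun A => ⟨fun h => ?_, hK.isSemidiversity.eq_zero A⟩,
    hK.isSemidiversity.triangle⟩
  obtain ⟨R, hR, hKR⟩ := hb.exists_pos_norm_lt
  refine Finset.card_le_one.2 fun a ha b hb => ?_
  rw [← sub_eq_zero, ← norm_le_zero_iff]
  have : ‖a - b‖ / (2 * R) ≤ generalizedCircumradius K A := by
    refine hK.le_generalizedCircumradius ?_
    rintro r ⟨hr, x, hx⟩
    obtain ⟨y, hy, rfl⟩ := hx a ha
    obtain ⟨z, hz, rfl⟩ := hx b hb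
    rw [div_le_iff₀ (by positivity), add_sub_add_right_eq_sub, ← smul_sub, norm_smul,
      Real.norm_of_nonneg hr]
    gcongr
    linarith [norm_sub_le y z, hKR y hy, hKR z hz]
  rwa [h, div_le_iff₀ (by positivity), zero_mul] at this

end Circumradius

/-! ### Möbius inversion and negative type. -/

section Moebius

variable {X : Type*} [Fintype X]

open IncidenceAlgebra

theorem sum_mu_of_le (U V : Finset X) :
    ∑ A with A ≤ V, mu ℝ U A = if U = V then 1 else 0 := by
  rw [← sum_Icc_mu_right]
  symm
  refine Finset.sum_subset (fun A hA => ?_) fun A hA hA' => ?_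
  · simpa using (Finset.mem_Icc.1 hA).2
  · refine apply_eq_zero_of_not_le (fun h => hA' ?_) _
    exact Finset.mem_Icc.2 ⟨h, by simpa using hA⟩

theorem sum_mu_mul_of_le (g : Finset X → ℝ) (A : Finset X) :
    ∑ V with A ≤ V, ∑ B, mu ℝ V B * g B = g A := by
  rw [Finset.sum_comm]
  have : ∀ B, ∑ V with A ≤ V, mu ℝ V B * g B = if A = B then g B else 0 := by
    intro B
    rw [← Finset.sum_mul, ← boole_mul, ← sum_Icc_mu_left]
    congr 1
    symm
    refine Finset.sum_subset (fun V hV => ?_) fun V hV hV' => ?_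
    · simpa using (Finset.mem_Icc.1 hV).1
    · refine apply_eq_zero_of_not_le (fun h => hV' ?_) _
      exact Finset.mem_Icc.2 ⟨by simpa using hV, h⟩
  simp [this]

/-- The indicator of `A ∪ B ≤ V` factors, so for each `V` the double sum is a square that vanishes
unless `V = U`. -/
theorem sum_mu_mul_mu (l : Finset X → ℝ) (U : Finset X) :
    ∑ A, ∑ B, mu ℝ U A * mu ℝ U B * ∑ V with A ∪ B ≤ V, l V = l U := by
  have h : ∀ A B, mu ℝ U A * mu ℝ U B * ∑ V with A ∪ B ≤ V, l V =
      ∑ V, l V * ((if A ≤ V then mu ℝ U A else 0) * if B ≤ V then mu ℝ U B else 0) := by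
    intro A B
    rw [Finset.sum_filter, Finset.mul_sum]
    refine Finset.sum_congr rfl fun V _ => ?_
    have : A ∪ B ≤ V ↔ A ≤ V ∧ B ≤ V := Finset.union_subset_iff
    simp only [this]
    by_cases hA : A ≤ V <;> by_cases hB : B ≤ V <;> simp [hA, hB, mul_comm]
  simp only [h]
  have h' : ∀ V, ∑ A, ∑ B, l V * ((if A ≤ V then mu ℝ U A else 0) *
      if B ≤ V then mu ℝ U B else 0) = if U = V then l V else 0 := by
    intro V
    simp only [← Finset.mul_sum, ← Finset.sum_mul, ← Finset.sum_filter, sum_mu_of_le]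
    split_ifs <;> simp
  rw [Finset.sum_congr rfl fun A _ => Finset.sum_comm, Finset.sum_comm,
    Finset.sum_congr rfl fun V _ => h' V, Finset.sum_ite_eq]
  simp

/-- A function of negative type is, up to a constant, a nonnegative combination of indicators
of the sets that are not contained in a given set. -/
theorem HasNegativeType.exists_weights {μ : Finset X → ℝ} (h : HasNegativeType μ) :
    ∃ (l : Finset X → ℝ) (m : ℝ), (∀ V, 0 ≤ l V) ∧
      ∀ A : Finset X, A.Nonempty → ∑ V, (if A ⊆ V then 0 else l V) = μ A + m := by
  set l : Finset X → ℝ := fun V => ∑ B, mu ℝ V B * -μ B with hl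
  have hg : ∀ A, ∑ V with A ≤ V, l V = -μ A := sum_mu_mul_of_le fun B => -μ B
  have hl0 : ∀ U, U ≠ ∅ → U ≠ Finset.univ → 0 ≤ l U := by
    intro U hU hU'
    -- The Möbius row of `U` is an admissible test vector: its entry at `∅` is zero since `U ≠ ∅`,
    -- and its sum is zero since `U ≠ univ`.
    have h1 := h (fun A => mu ℝ U A)
      (apply_eq_zero_of_not_le (fun h => hU (Finset.subset_empty.1 h)) _)
      (by simpa [hU'] using sum_mu_of_le U Finset.univ)
    rw [← sum_mu_mul_mu l U]
    simp only [hg, mul_neg, Finset.sum_neg_distrib]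
    simpa using h1
  -- The two weights of unknown sign can be discarded: for nonempty `A`, the set `univ` always
  -- contains `A` and `∅` never does, so they affect only the constant.
  let l' : Finset X → ℝ := fun V => if V = ∅ ∨ V = Finset.univ then 0 else l V
  refine ⟨l', ∑ V, l' V + l Finset.univ, fun V => ?_, fun A hA => ?_⟩
  · by_cases hV : V = ∅ ∨ V = Finset.univ
    · simp [l', hV]
    · simp only [l', hV, if_false]
      exact hl0 V (fun h => hV (.inl h)) fun h => hV (.inr h)
  · have h1 : ∀ V, (if A ≤ V then l V else 0) =
        l' V - (if A ⊆ V then 0 else l' V) + if V = Finset.univ then l V else 0 := by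
      intro V
      by_cases hV : V = Finset.univ
      · subst hV
        simp [l']
      · by_cases hAV : A ⊆ V
        · have : V ≠ ∅ := (hA.mono hAV).ne_empty
          simp [l', hV, hAV, this]
        · simp [hV, hAV]
    have h2 := hg A
    rw [Finset.sum_filter, Finset.sum_congr rfl fun V _ => h1 V, Finset.sum_add_distrib,
      Finset.sum_sub_distrib] at h2
    simp only [Finset.sum_ite_eq', Finset.mem_univ, if_true] at h2
    linarith

end Moebius

/-! ### The bounded product kernel. -/

section SimplexKernel

variable {ι κ : Type*} [Fintype κ]

/-- The block average of a vector of `ℝᵏ` whose coordinates are indexed by `ι × κ`. -/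
def blockMean {k : ℕ} (e : ι × κ ≃ Fin k) (i : ι) (y : Euc k) : ℝ :=
  (∑ v, y (e (i, v))) / Fintype.card κ

/-- A bounded kernel in `ℝ^(ι × κ)`: the product over `ι` of cylinders over simplices. -/
def simplexKernel {k : ℕ} (e : ι × κ ≃ Fin k) : Set (Euc k) :=
  {y | ∀ i, |blockMean e i y| ≤ 1 ∧
    ∀ v, y (e (i, v)) - blockMean e i y ≤ 1 / Fintype.card κ}

variable {k : ℕ} (e : ι × κ ≃ Fin k)

theorem blockMean_add (i : ι) (y z : Euc k) :
    blockMean e i (y + z) = blockMean e i y + blockMean e i z := by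
  simp [blockMean, Finset.sum_add_distrib, add_div]

theorem blockMean_smul (i : ι) (r : ℝ) (y : Euc k) :
    blockMean e i (r • y) = r * blockMean e i y := by
  simp [blockMean, ← Finset.mul_sum, mul_div_assoc]

theorem continuous_blockMean (i : ι) : Continuous (blockMean e i) := by
  unfold blockMean
  fun_prop

theorem sum_sub_blockMean [Nonempty κ] (i : ι) (y : Euc k) :
    ∑ v, (y (e (i, v)) - blockMean e i y) = 0 := by
  simp only [blockMean, Finset.sum_sub_distrib, Finset.sum_const, Finset.card_univ, nsmul_eq_mul]
  field_simp
  simp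

theorem isClosed_simplexKernel : IsClosed (simplexKernel e) := by
  have h := continuous_blockMean e
  simp only [simplexKernel, Set.ofPred_forall, Set.ofPred_and]
  refine isClosed_iInter fun i => (isClosed_le (h i).abs continuous_const).inter
    (isClosed_iInter fun v => isClosed_le (Continuous.sub (by fun_prop) (h i)) continuous_const)

theorem convex_simplexKernel : Convex ℝ (simplexKernel e) := by
  intro y hy z hz a b ha hb hab i
  obtain ⟨hy1, hy2⟩ := hy i
  obtain ⟨hz1, hz2⟩ := hz i
  rw [blockMean_add, blockMean_smul, blockMean_smul]
  refine ⟨?_, fun v => ?_⟩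
  · rw [abs_le] at *
    constructor <;> nlinarith
  · have h1 := mul_le_mul_of_nonneg_left (hy2 v) ha
    have h2 := mul_le_mul_of_nonneg_left (hz2 v) hb
    have h3 : a * (1 / (Fintype.card κ : ℝ)) + b * (1 / (Fintype.card κ : ℝ)) =
        1 / Fintype.card κ := by rw [← add_mul, hab, one_mul]
    simp only [PiLp.add_apply, PiLp.smul_apply, smul_eq_mul]
    linarith

theorem interior_simplexKernel_nonempty [Finite ι] [Nonempty κ] : (interior (simplexKernel e)).Nonempty := by
  refine ⟨0, mem_interior_iff_mem_nhds.2 ?_⟩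
  have h := continuous_blockMean e
  have h0 : ∀ i, blockMean e i 0 = 0 := fun i => by simp [blockMean]
  have hN : (0 : ℝ) < 1 / Fintype.card κ := by positivity
  simp only [simplexKernel, Set.ofPred_forall, Set.ofPred_and]
  refine Filter.iInter_mem.2 fun i => Filter.inter_mem ?_ (Filter.iInter_mem.2 fun v => ?_)
  · exact (h i).abs.continuousAt.eventually_le_const (by simp [h0])
  · exact (Continuous.sub (by fun_prop) (h i)).continuousAt.eventually_le_const
      (by simpa [h0] using Fintype.card_pos)

theorem isBounded_simplexKernel [Nonempty κ] : Bornology.IsBounded (simplexKernel e) := by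
  have hN : (1 : ℝ) ≤ Fintype.card κ := by exact_mod_cast Fintype.card_pos
  have hN' : 1 / (Fintype.card κ : ℝ) ≤ 1 := by rw [div_le_one (by positivity)]; exact hN
  have hbound : ∀ y ∈ simplexKernel e, ∀ i v, |y (e (i, v))| ≤ 2 := by
    intro y hy i v
    obtain ⟨h1, h2⟩ := hy i
    rw [abs_le] at h1 ⊢
    have h3 := sum_sub_blockMean e i y
    rw [← Finset.add_sum_erase _ _ (Finset.mem_univ v)] at h3
    have h4 : ∑ w ∈ Finset.univ.erase v, (y (e (i, w)) - blockMean e i y) ≤ 1 := by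
      refine (Finset.sum_le_card_nsmul _ _ _ fun w _ => h2 w).trans ?_
      rw [nsmul_eq_mul, mul_one_div, div_le_one (by positivity)]
      exact_mod_cast Finset.card_le_univ _
    constructor <;> linarith [h2 v]
  refine (Metric.isBounded_iff_subset_closedBall (0 : Euc k)).2 ⟨Real.sqrt (∑ _ : Fin k, 2 ^ 2), ?_⟩
  intro y hy
  rw [mem_closedBall_zero_iff, EuclideanSpace.norm_eq]
  refine Real.sqrt_le_sqrt (Finset.sum_le_sum fun j _ => ?_)
  have := hbound y hy (e.symm j).1 (e.symm j).2
  rw [Prod.mk.eta, e.apply_symm_apply] at this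
  exact pow_le_pow_left₀ (norm_nonneg _) this 2

theorem isKernel_simplexKernel [Finite ι] [Nonempty κ] : IsKernel (simplexKernel e) :=
  ⟨isClosed_simplexKernel e, convex_simplexKernel e, interior_simplexKernel_nonempty e⟩

end SimplexKernel

/-! ### Circumradii for the product kernel and the embedding. -/

section Embedding

variable {ι κ : Type*} [Fintype κ] [Nonempty κ] {k : ℕ} {e : ι × κ ≃ Fin k}
  {A : Finset (Euc k)} {m : ι → ℝ}

/-- Summing the facet inequalities over block `i` eliminates the translation, since deviations from
a block mean sum to zero. -/
theorem le_of_mem_coverScales_simplexKernel (hm : ∀ a ∈ A, ∀ i, blockMean e i a = m i)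
    {r : ℝ} (hr : r ∈ coverScales (simplexKernel e) A) {M : ι → κ → ℝ} (i : ι)
    (hM : ∀ v, ∃ a ∈ A, a (e (i, v)) = M i v) :
    ∑ v, (M i v - m i) ≤ r := by
  obtain ⟨hr0, x, hx⟩ := hr
  have h : ∀ v, M i v - m i - (x (e (i, v)) - blockMean e i x) ≤ r * (1 / Fintype.card κ) := by
    intro v
    obtain ⟨a, ha, hav⟩ := hM v
    obtain ⟨y, hy, rfl⟩ := hx a ha
    rw [← hm _ ha i, ← hav, blockMean_add, blockMean_smul]
    have := mul_le_mul_of_nonneg_left ((hy i).2 v) hr0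
    simp only [PiLp.add_apply, PiLp.smul_apply, smul_eq_mul]
    linarith
  have h2 := Finset.sum_le_sum fun v (_ : v ∈ Finset.univ) => h v
  rw [Finset.sum_sub_distrib, sum_sub_blockMean, sub_zero] at h2
  refine h2.trans_eq ?_
  rw [Finset.sum_const, Finset.card_univ, nsmul_eq_mul]
  field_simp

theorem mem_coverScales_simplexKernel (hm : ∀ a ∈ A, ∀ i, blockMean e i a = m i)
    {r : ℝ} (hr : 0 < r) {M : ι → κ → ℝ} (hM : ∀ a ∈ A, ∀ i v, a (e (i, v)) ≤ M i v)
    (hMr : ∀ i, ∑ v, (M i v - m i) ≤ r) : r ∈ coverScales (simplexKernel e) A := by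
  let N : ℝ := Fintype.card κ
  have hN : 0 < N := by positivity
  -- The coordinatewise upper bounds are lowered equally within each block until its mean is `m i`;
  -- then `a - x` has block means zero and meets the facet bounds.
  let x : Euc k := WithLp.toLp 2 fun j => M (e.symm j).1 (e.symm j).2 -
    (∑ v, (M (e.symm j).1 v - m (e.symm j).1)) / N
  have hx : ∀ i v, x (e (i, v)) = M i v - (∑ v, (M i v - m i)) / N := by
    intro i v
    simp [x]
  have hxm : ∀ i, blockMean e i x = m i := by
    intro i
    simp only [blockMean, hx, Finset.sum_sub_distrib, Finset.sum_const, Finset.card_univ,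
      nsmul_eq_mul]
    change (_ - N * ((_ - N * _) / N)) / N = _
    field_simp
    ring
  refine ⟨hr.le, x, fun a ha => ⟨r⁻¹ • (a + (-1 : ℝ) • x), fun i => ?_, ?_⟩⟩
  · have h0 : blockMean e i (r⁻¹ • (a + (-1 : ℝ) • x)) = 0 := by
      rw [blockMean_smul, blockMean_add, blockMean_smul, hm a ha, hxm]
      ring
    rw [h0]
    refine ⟨by simp, fun v => ?_⟩
    simp only [PiLp.add_apply, PiLp.smul_apply, smul_eq_mul, hx, sub_zero]
    rw [inv_mul_le_iff₀ hr, mul_one_div]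
    have := div_le_div_of_nonneg_right (hMr i) hN.le
    linarith [hM a ha i v]
  · rw [smul_inv_smul₀ hr.ne']
    simp

variable {X : Type*} [Fintype X]

theorem IsMaxOfNegativeType.boundedMinkowskiEmbeddable {δ : Finset X → ℝ} (hδ : IsDiversity δ)
    (h : IsMaxOfNegativeType δ) : BoundedMinkowskiEmbeddable δ := by
  obtain ⟨S, hS, hmax⟩ := h
  choose μ hμS hμ using fun A => (hmax A).1
  have hle : ∀ A B, μ A B ≤ δ B := fun A B => (hmax B).2 ⟨_, hμS A, rfl⟩
  choose l m hl hlm using fun A => (hS _ (hμS A)).2.exists_weights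
  let e := Fintype.equivFin (Finset X × Finset X)
  let N : ℝ := Fintype.card (Finset X)
  have hN : 0 < N := by positivity
  let f : X → Euc (Fintype.card (Finset X × Finset X)) := fun a => WithLp.toLp 2 fun j =>
    if a ∈ (e.symm j).2 then 0 else l (e.symm j).1 (e.symm j).2
  have hf : ∀ a i v, f a (e (i, v)) = if a ∈ v then 0 else l i v := by
    intro a i v
    simp [f]
  -- All image points share their block means because each `μ` vanishes on singletons.
  have hmean : ∀ a i, blockMean e i (f a) = m i / N := by
    intro a i
    have := hlm i {a} (by simp)
    simp only [Finset.singleton_subset_iff] at this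
    rw [blockMean, Finset.sum_congr rfl fun v _ => hf a i v, this,
      (hS _ (hμS i)).1.eq_zero _ (by simp), zero_add]
  refine ⟨_, simplexKernel e, f, isKernel_simplexKernel e, isBounded_simplexKernel e, fun A => ?_⟩
  suffices generalizedCircumradius (simplexKernel e) (A.image f) = δ A by convert this
  -- `mem_coverScales_simplexKernel` needs a positive scale, so sets with `δ A = 0` are treated
  -- apart.
  rcases le_or_gt A.card 1 with hA | hA
  · rw [(hδ.eq_zero_iff A).2 hA]
    exact generalizedCircumradius_eq_zero (isKernel_simplexKernel e).nonempty
      (Finset.card_image_le.trans hA)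
  have hne : A.Nonempty := Finset.card_pos.1 (by omega)
  have hpos : 0 < δ A := (hδ.nonneg A).lt_of_ne fun h => by
    have := (hδ.eq_zero_iff A).1 h.symm
    omega
  let M : Finset X → Finset X → ℝ := fun i v => if A ⊆ v then 0 else l i v
  have hMsum : ∀ i, ∑ v, (M i v - m i / N) = μ i A := by
    intro i
    rw [Finset.sum_sub_distrib, hlm i A hne, Finset.sum_const, Finset.card_univ, nsmul_eq_mul,
      mul_div_cancel₀ _ hN.ne', add_sub_cancel_right]
  have hm : ∀ b ∈ A.image f, ∀ i, blockMean e i b = m i / N := by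
    intro b hb i
    obtain ⟨a, -, rfl⟩ := Finset.mem_image.1 hb
    exact hmean a i
  refine le_antisymm (generalizedCircumradius_le ?_)
    ((isKernel_simplexKernel e).le_generalizedCircumradius fun r hr => ?_)
  · refine mem_coverScales_simplexKernel hm hpos (M := M) ?_ fun i => (hMsum i).trans_le (hle i A)
    intro b hb i v
    obtain ⟨a, ha, rfl⟩ := Finset.mem_image.1 hb
    rw [hf]
    by_cases hAv : A ⊆ v
    · simp [M, hAv, hAv ha]
    · simp only [M, hAv, if_false]
      split_ifs
      exacts [hl i v, le_rfl]
  · have hμA : μ A A = δ A := hμ A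
    rw [← hμA, ← hMsum]
    refine le_of_mem_coverScales_simplexKernel hm hr A fun v => ?_
    by_cases hAv : A ⊆ v
    · obtain ⟨a, ha⟩ := hne
      exact ⟨f a, Finset.mem_image_of_mem f ha, by simp [hf, M, hAv, hAv ha]⟩
    · obtain ⟨a, ha, hav⟩ := Finset.not_subset.1 hAv
      exact ⟨f a, Finset.mem_image_of_mem f ha, by simp [hf, M, hAv, hav]⟩

end Embedding

end Diversity

end

theorem mainTheorem6 {X : Type*} [Fintype X] (δ : Finset X → ℝ) (hδ : Diversity.IsDiversity δ) :
    List.TFAE [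
      Diversity.SublinearEmbeddable δ,
      Diversity.MinkowskiEmbeddable δ,
      Diversity.BoundedMinkowskiEmbeddable δ,
      Diversity.IsMaxOfNegativeType δ] := by
  tfae_have 1 → 4 := fun ⟨_, _, _, hη, hl, hf⟩ => hl.isMaxOfNegativeType hη.isSemidiversity hf
  tfae_have 2 → 4 := fun ⟨_, _, _, hK, hf⟩ =>
    hK.isSublinear.isMaxOfNegativeType hK.isSemidiversity hf
  tfae_have 3 → 1 := fun ⟨k, K, f, hK, hb, hf⟩ =>
    ⟨k, _, f, hK.isDiversity hb, hK.isSublinear, hf⟩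
  tfae_have 3 → 2 := fun ⟨k, K, f, hK, _, hf⟩ => ⟨k, K, f, hK, hf⟩
  tfae_have 4 → 3 := fun h => h.boundedMinkowskiEmbeddable hδ
  tfae_finish
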